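/- All manifolds are Hausdorff, second countable, real and $C^\infty$; all maps, fields and forms are $C^\infty$. Let $m\ge 1$, $n\ge 0$, let $\kappa\colon\mathcal M\to M$ be a fibred manifold (a surjective submersion, for instance a fibre bundle) with $\dim M=m$, $\dim\mathcal M=m+n$, let $\eta$ be a volume form on $M$, $\omega=\kappa^*\eta$, and let $\Omega\in\Omega^{m+1}(\mathcal M)$ be closed; $(\mathcal M,\Omega,\omega)$ is called a (pre)multisymplectic system. For $V\subset\mathcal M$ open, an $m$-multivector field on $V$ is a section $\mathbf X$ of $\Lambda^m T\mathcal M$ over $V$. It is locally decomposable if locally $\mathbf X=X_1\wedge\dots\wedge X_m$ with vector fields $X_i$. If $\mathbf X$ is non-vanishing and locally decomposable, $\mathcal D(\mathbf X)=\{v : v\wedge\mathbf X=0\}$ is its associated $m$-dimensional distribution; an integral submanifold of $\mathbf X$ is an injectively immersed $m$-dimensional submanifold $j\colon S\to V$ with $T_sj(T_sS)=\mathcal D_{j(s)}(\mathbf X)$ for all $s\in S$; and $\mathbf X$ is integrable if through every point of $V$ there passes an integral submanifold. Let $\ker^m\Omega$ (on $V$) be the set of $m$-multivector fields on $V$ with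 $i(\mathbf X)\Omega=0$, and $\ker^m_{\omega(I)}\Omega$ (on $V$) the set of integrable $\mathbf X\in\ker^m\Omega$ with $i(\mathbf X)\omega\neq0$ at every point of $V$. A local flow of a vector field $Y$ consists of an open interval $J\ni0$, an open set $U$ and diffeomorphisms $F_t\colon U\to F_t(U)$ onto open sets ($t\in J$), jointly smooth in $(t,p)$, such that $F_0=\mathrm{id}_U$ and $t\mapsto F_t(p)$ is an integral curve of $Y$ for each $p\in U$. For an $m$-multivector field $\mathbf X$ on $\mathcal M$, $F_{t*}\mathbf X$ is the $m$-multivector field on $F_t(U)$ with $(F_{t*}\mathbf X)_{F_t(p)}=\Lambda^m(T_pF_t)\mathbf X_p$. The vector field $Y\in\mathfrak X(\mathcal M)$ is an infinitesimal symmetry if, for every local flow $F_t$ of $Y$ and every $\mathbf X\in\ker^m\Omega$ on $\mathcal M$, $F_{t*}\mathbf X\in\ker^m\Omega$ on $F_t(U)$. It is $\kappa$-projectable if there is $Z\in\mathfrak X(M)$ such that the local flows of $Y$ and $Z$ are $\kappa$-related: every local flow $(J,U,F_t)$ of $Y$ covers a local flow $(J,\kappa(U),G_t)$ of $Z$, i.e.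 $\kappa\circ F_t=G_t\circ\kappa$ on $U$. **Theorem.** Let $Y\in\mathfrak X(\mathcal M)$ be an infinitesimal symmetry of $(\mathcal M,\Omega,\omega)$, and let $F_t\colon U\to F_t(U)$, $t\in J$, be a local flow of $Y$. Then for every $t\in J$: 1. If $\mathbf X\in\ker^m\Omega$ (on $\mathcal M$) is integrable, then $F_{t*}\mathbf X$ is an integrable multivector field on $F_t(U)$, and $F_t$ transforms integral submanifolds of $\mathbf X$ into integral submanifolds of $F_{t*}\mathbf X$: if $j\colon S\to\mathcal M$ is an integral submanifold of $\mathbf X$, then $F_t\circ j|_{j^{-1}(U)}$ is an integral submanifold of $F_{t*}\mathbf X$. 2. If moreover $Y$ is $\kappa$-projectable, then for every $\mathbf X\in\ker^m_{\omega(I)}\Omega$ (on $\mathcal M$), $F_t$ transforms integral submanifolds of $\mathbf X$ into integral submanifolds of $F_{t*}\mathbf X$, and $F_{t*}\mathbf X\in\ker^m_{\omega(I)}\Omega$ on $F_t(U)$. -/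

import Mathlib

universe u v w

open Set TopologicalSpace
open scoped Manifold ContDiff

noncomputable section

namespace Multisymplectic

/-! ### Multilinear algebra -/

section Algebra

variable {V : Type*} [AddCommGroup V] [Module ℝ V] {m : ℕ}

/-- The contraction `i(x)α ∈ ℝ` of an `m`-vector `x` with an `m`-form `α`: the linear extension of
`i(v₁ ∧ … ∧ vₘ)α = i(v₁) … i(vₘ)α = α(vₘ, …, v₁)`. -/
def contractTop (x : ⋀[ℝ]^m V) (α : V [⋀^Fin m]→ₗ[ℝ] ℝ) : ℝ :=
  exteriorPower.alternatingMapLinearEquiv (α.domDomCongr Fin.revPerm) x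

/-- The contraction `i(x)α` of an `m`-vector `x` with an `(m+1)`-form `α`, which is a `1`-form: the
linear extension in `x` of `i(v₁ ∧ … ∧ vₘ)α = i(v₁) … i(vₘ)α = α(vₘ, …, v₁, ·)`. -/
def contract (x : ⋀[ℝ]^m V) (α : V [⋀^Fin (m + 1)]→ₗ[ℝ] ℝ) (v : V) : ℝ :=
  contractTop x ((α.domDomCongr (finRotate (m + 1))).curryLeft v)

theorem contractTop_ιMulti (w : Fin m → V) (α : V [⋀^Fin m]→ₗ[ℝ] ℝ) :
    contractTop (exteriorPower.ιMulti ℝ m w) α = α (w ∘ Fin.rev) := by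
  simp only [contractTop, exteriorPower.alternatingMapLinearEquiv_apply_ιMulti]
  rfl

theorem contract_ιMulti (w : Fin m → V) (α : V [⋀^Fin (m + 1)]→ₗ[ℝ] ℝ) (v : V) :
    contract (exteriorPower.ιMulti ℝ m w) α v =
      α (Fin.snoc (α := fun _ => V) (w ∘ Fin.rev) v) := by
  rw [contract, contractTop_ιMulti, Fin.snoc_eq_cons_rotate]
  rfl

/-- The annihilator `{v | v ∧ x = 0}` of an `m`-vector `x`. If `x = v₁ ∧ … ∧ vₘ ≠ 0` this is the
`m`-dimensional subspace `D = span(v₁, …, vₘ)`, the only one such that `x ∈ Λᵐ D`. -/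
def wedgeKer (x : ⋀[ℝ]^m V) : Submodule ℝ V :=
  LinearMap.ker (LinearMap.mulRight ℝ (x : ExteriorAlgebra ℝ V) ∘ₗ ExteriorAlgebra.ι ℝ)

theorem mem_wedgeKer {x : ⋀[ℝ]^m V} {v : V} :
    v ∈ wedgeKer x ↔ ExteriorAlgebra.ι ℝ v * (x : ExteriorAlgebra ℝ V) = 0 := Iff.rfl

theorem ιMulti_ne_zero {w : Fin m → V} (hw : LinearIndependent ℝ w) :
    ExteriorAlgebra.ιMulti ℝ m w ≠ 0 := by
  have h := (exteriorPower.ιMulti_family_linearIndependent_field (n := m) hw).ne_zero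
    (Set.powersetCard.ofFinEmbEquiv (RelEmbedding.refl _))
  intro h0
  apply h
  ext
  simp only [exteriorPower.ιMulti_family_apply_coe, ExteriorAlgebra.ιMulti_family,
    Equiv.symm_apply_apply]
  exact h0

theorem wedgeKer_ιMulti {w : Fin m → V} (hw : LinearIndependent ℝ w) :
    wedgeKer (exteriorPower.ιMulti ℝ m w) = Submodule.span ℝ (Set.range w) := by
  have key : ∀ v, v ∈ wedgeKer (exteriorPower.ιMulti ℝ m w) ↔
      ExteriorAlgebra.ιMulti ℝ (m + 1) (Fin.cons v w : Fin (m + 1) → V) = 0 := by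
    intro v
    rw [mem_wedgeKer, exteriorPower.ιMulti_apply_coe, ExteriorAlgebra.ιMulti_succ_apply]
    simp [Matrix.vecTail, Function.comp_def]
  ext v
  rw [key]
  constructor
  · intro h
    by_contra hv
    exact ιMulti_ne_zero (linearIndependent_finCons.2 ⟨hw, hv⟩) h
  · intro h
    apply AlternatingMap.map_linearDependent
    intro h2
    exact (linearIndependent_finCons.1 h2).2 h

end Algebra

/-! ### Vector fields, multivector fields and forms on a manifold -/

section Manifold

variable {k : ℕ} {N : Type u} [TopologicalSpace N] [ChartedSpace (EuclideanSpace ℝ (Fin k)) N]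
  [IsManifold (𝓡 k) ∞ N]

/-- `Y` is a smooth vector field on the open set `U`. -/
def IsVectorFieldOn (Y : (p : N) → TangentSpace (𝓡 k) p) (U : Set N) : Prop :=
  ContMDiffOn (𝓡 k) (𝓡 k).tangent ∞ (fun p => (⟨p, Y p⟩ : TangentBundle (𝓡 k) N)) U

variable (k N) in
/-- Sections of `Λᵐ TN`, not necessarily smooth. -/
abbrev MultivectorField (m : ℕ) : Type _ := (p : N) → ⋀[ℝ]^m (TangentSpace (𝓡 k) p)

/-- `X` is a smooth `m`-multivector field on the open set `U`: around every point of `U`,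
`X = ∑_{i₁ < … < iₘ} f^{i₁ … iₘ} X_{i₁} ∧ … ∧ X_{iₘ}` with smooth functions `f^{i₁ … iₘ}` and smooth
vector fields `X₁, …, X_r`. -/
def IsMultivectorFieldOn {m : ℕ} (X : MultivectorField k N m) (U : Set N) : Prop :=
  ∀ p ∈ U, ∃ W : Set N, IsOpen W ∧ p ∈ W ∧ W ⊆ U ∧
    ∃ (r : ℕ) (A : Fin r → (q : N) → TangentSpace (𝓡 k) q) (f : (Fin m ↪o Fin r) → N → ℝ),
      (∀ i, IsVectorFieldOn (A i) W) ∧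
      (∀ I, ContMDiffOn (𝓡 k) 𝓘(ℝ, ℝ) ∞ (f I) W) ∧
      ∀ q ∈ W, X q = ∑ I, f I q • exteriorPower.ιMulti ℝ m (fun i => A (I i) q)

/-- `X` is locally decomposable on the open set `U`: around every point of `U` it is the wedge
product of `m` smooth vector fields. -/
def IsLocallyDecomposableOn {m : ℕ} (X : MultivectorField k N m) (U : Set N) : Prop :=
  ∀ p ∈ U, ∃ W : Set N, IsOpen W ∧ p ∈ W ∧ W ⊆ U ∧
    ∃ A : Fin m → (q : N) → TangentSpace (𝓡 k) q,
      (∀ i, IsVectorFieldOn (A i) W) ∧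
      ∀ q ∈ W, X q = exteriorPower.ιMulti ℝ m (fun i => A i q)

/-- The distribution `𝓓(X)` of a non-vanishing locally decomposable multivector field. -/
def distribution {m : ℕ} (X : MultivectorField k N m) (p : N) :
    Submodule ℝ (TangentSpace (𝓡 k) p) :=
  wedgeKer (X p)

/-- The injective immersion `j : S → N` of an `m`-dimensional manifold `S` is an integral
submanifold, contained in the open set `U`, of the multivector field `X` given on `U`: the image of
`T_s j` is `𝓓(X)` at `j s`, for all `s ∈ S`. -/
structure IsIntegralSubmanifoldOn {m : ℕ} (X : MultivectorField k N m) (U : Set N)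
    {S : Type*} [TopologicalSpace S] [ChartedSpace (EuclideanSpace ℝ (Fin m)) S]
    (j : S → N) : Prop where
  smooth : ContMDiff (𝓡 m) (𝓡 k) ∞ j
  injective : Function.Injective j
  immersion : ∀ s, Function.Injective (mfderiv (𝓡 m) (𝓡 k) j s)
  mem : ∀ s, j s ∈ U
  tangent : ∀ s, LinearMap.range (mfderiv (𝓡 m) (𝓡 k) j s).toLinearMap = distribution X (j s)

/-- `X` is an integrable multivector field on the open set `U`: it is non-vanishing and locally
decomposable, and through every point of `U` there passes an integral submanifold. -/
structure IsIntegrableOn {m : ℕ} (X : MultivectorField k N m) (U : Set N) : Prop where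
  ne_zero : ∀ p ∈ U, X p ≠ 0
  locallyDecomposable : IsLocallyDecomposableOn X U
  exists_integral : ∀ p ∈ U, ∃ (S : Type) (_ : TopologicalSpace S) (_ : SecondCountableTopology S)
    (_ : ChartedSpace (EuclideanSpace ℝ (Fin m)) S) (_ : IsManifold (𝓡 m) ∞ S) (j : S → N),
      IsIntegralSubmanifoldOn X U j ∧ p ∈ range j

/-- The push-forward `Φ_* X`, given on the target of the local diffeomorphism `Φ` by
`(Φ_* X)(Φ p) = Λᵐ(T_p Φ)(X p)`. -/
def pushforward {m : ℕ} (Φ : OpenPartialHomeomorph N N) (X : MultivectorField k N m) :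
    MultivectorField k N m :=
  fun q => (exteriorPower.map m (mfderiv (𝓡 k) (𝓡 k) Φ (Φ.symm q)).toLinearMap (X (Φ.symm q)) :)

variable (k N) in
/-- Fields of alternating `r`-forms on the tangent spaces, not necessarily smooth. -/
abbrev FormField (r : ℕ) : Type _ := (p : N) → TangentSpace (𝓡 k) p [⋀^Fin r]→L[ℝ] ℝ

/-- The expression of a form in the preferred chart at `x`: its pull-back by the inverse chart. -/
def FormField.inChart {r : ℕ} (α : FormField k N r) (x : N) (y : EuclideanSpace ℝ (Fin k)) :
    EuclideanSpace ℝ (Fin k) [⋀^Fin r]→L[ℝ] ℝ :=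
  (α ((extChartAt (𝓡 k) x).symm y)).compContinuousLinearMap
    (mfderiv 𝓘(ℝ, EuclideanSpace ℝ (Fin k)) (𝓡 k) (extChartAt (𝓡 k) x).symm y)

/-- `α` is a smooth differential form. -/
def FormField.IsSmooth {r : ℕ} (α : FormField k N r) : Prop :=
  ∀ x : N, ContDiffOn ℝ ∞ (α.inChart x) (extChartAt (𝓡 k) x).target

/-- `dα = 0`, the exterior derivative being computed in charts. -/
def FormField.IsClosed {r : ℕ} (α : FormField k N r) : Prop :=
  ∀ x : N, ∀ y ∈ (extChartAt (𝓡 k) x).target, extDeriv (α.inChart x) y = 0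

/-- A local flow (local one-parameter group of local diffeomorphisms) of the vector field `Y`: an
open interval `J ∋ 0`, an open set `U` and diffeomorphisms `F_t` (`t ∈ J`) of `U` onto open sets
`F_t(U)`, such that `(t, p) ↦ F_t(p)` is smooth on `J × U`, `F_0 = id` and, for `p ∈ U`,
`t ↦ F_t(p)` is an integral curve of `Y`. The value of `flow t` for `t ∉ J` is irrelevant. -/
structure LocalFlow (Y : (p : N) → TangentSpace (𝓡 k) p) where
  J : Set ℝ
  isOpen_J : IsOpen J
  ordConnected_J : J.OrdConnected
  zero_mem : (0 : ℝ) ∈ J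
  U : Set N
  isOpen_U : IsOpen U
  flow : ℝ → OpenPartialHomeomorph N N
  source_eq : ∀ t ∈ J, (flow t).source = U
  smooth : ContMDiffOn (𝓘(ℝ, ℝ).prod (𝓡 k)) (𝓡 k) ∞ (fun z : ℝ × N => flow z.1 z.2) (J ×ˢ U)
  smooth_symm : ∀ t ∈ J, ContMDiffOn (𝓡 k) (𝓡 k) ∞ (flow t).symm (flow t).target
  flow_zero : ∀ p ∈ U, flow 0 p = p
  integralCurve : ∀ p ∈ U, IsMIntegralCurveOn (I := 𝓡 k) (fun t => flow t p) Y J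

/-- The local diffeomorphism `Φ` transforms integral submanifolds of `X` into integral submanifolds
of `X'`: if `j : S → N` is an integral submanifold of `X`, then the restriction of `Φ ∘ j` to the
open subset `T` of `S` where it is defined is an integral submanifold of `X'` in the target. -/
def MapsIntegralSubmanifolds {m : ℕ} (Φ : OpenPartialHomeomorph N N)
    (X X' : MultivectorField k N m) : Prop :=
  ∀ (S : Type v) [TopologicalSpace S] [SecondCountableTopology S]
    [ChartedSpace (EuclideanSpace ℝ (Fin m)) S] [IsManifold (𝓡 m) ∞ S] (j : S → N),
    IsIntegralSubmanifoldOn X univ j →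
    ∀ T : Opens S, (T : Set S) = j ⁻¹' Φ.source →
      IsIntegralSubmanifoldOn X' Φ.target (fun s : T => Φ (j s))

end Manifold

/-! ### (Pre)multisymplectic systems -/

/-- A (pre)multisymplectic system `(𝓜, Ω, ω)` with `ω = κ^*η`: a fibred manifold `κ : 𝓜 → M` over an
`m`-dimensional manifold with volume form `η`, and a closed form `Ω ∈ Ω^{m+1}(𝓜)`. -/
structure PremultisymplecticSystem (m n : ℕ)
    (P : Type*) [TopologicalSpace P] [ChartedSpace (EuclideanSpace ℝ (Fin (m + n))) P]
    [IsManifold (𝓡 (m + n)) ∞ P]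
    (M : Type*) [TopologicalSpace M] [ChartedSpace (EuclideanSpace ℝ (Fin m)) M]
    [IsManifold (𝓡 m) ∞ M] where
  κ : P → M
  κ_smooth : ContMDiff (𝓡 (m + n)) (𝓡 m) ∞ κ
  κ_surjective : Function.Surjective κ
  κ_submersion : ∀ p, Function.Surjective (mfderiv (𝓡 (m + n)) (𝓡 m) κ p)
  η : FormField m M m
  η_smooth : η.IsSmooth
  η_ne_zero : ∀ x, η x ≠ 0
  Ω : FormField (m + n) P (m + 1)
  Ω_smooth : Ω.IsSmooth
  Ω_closed : Ω.IsClosed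

namespace PremultisymplecticSystem

variable {m n : ℕ}
  {P : Type*} [TopologicalSpace P] [ChartedSpace (EuclideanSpace ℝ (Fin (m + n))) P]
  [IsManifold (𝓡 (m + n)) ∞ P]
  {M : Type*} [TopologicalSpace M] [ChartedSpace (EuclideanSpace ℝ (Fin m)) M]
  [IsManifold (𝓡 m) ∞ M]
  (𝒮 : PremultisymplecticSystem m n P M)

/-- The form `ω = κ^*η`. -/
def volForm : FormField (m + n) P m :=
  fun p => (𝒮.η (𝒮.κ p)).compContinuousLinearMap (mfderiv (𝓡 (m + n)) (𝓡 m) 𝒮.κ p)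

/-- `ker^m Ω` over the open set `U`: the `m`-multivector fields `X` on `U` with `i(X)Ω = 0`. -/
def kerOn (U : Set P) : Set (MultivectorField (m + n) P m) :=
  {X | IsMultivectorFieldOn X U ∧
    ∀ p ∈ U, ∀ v : TangentSpace (𝓡 (m + n)) p, contract (X p) (𝒮.Ω p).toAlternatingMap v = 0}

/-- `ker^m_{ω(I)} Ω` over the open set `U`: the integrable `m`-multivector fields `X` on `U` with
`i(X)Ω = 0` and with `i(X)ω` nowhere zero. -/
def kerIntegrableOn (U : Set P) : Set (MultivectorField (m + n) P m) :=
  {X | X ∈ 𝒮.kerOn U ∧ (∀ p ∈ U, contractTop (X p) (𝒮.volForm p).toAlternatingMap ≠ 0) ∧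
    IsIntegrableOn X U}

/-- `Y` is an infinitesimal symmetry: a vector field all of whose local flows `F_t` satisfy
`F_{t*}(ker^m Ω) ⊂ ker^m Ω` in the corresponding open sets. -/
def IsInfinitesimalSymmetry (Y : (p : P) → TangentSpace (𝓡 (m + n)) p) : Prop :=
  IsVectorFieldOn Y univ ∧
    ∀ F : LocalFlow Y, ∀ t ∈ F.J, ∀ X ∈ 𝒮.kerOn univ,
      pushforward (F.flow t) X ∈ 𝒮.kerOn (F.flow t).target

/-- `Y` is `κ`-projectable: there is a vector field `Z` on the base such that the local flows of `Y`
and `Z` are `κ`-related, i.e. every local flow `F_t` of `Y`, defined for `t ∈ J` on `U`, covers a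
local flow `G_t` of `Z`, defined for `t ∈ J` on `κ(U)`: `κ ∘ F_t = G_t ∘ κ`. -/
def IsProjectable (Y : (p : P) → TangentSpace (𝓡 (m + n)) p) : Prop :=
  ∃ Z : (x : M) → TangentSpace (𝓡 m) x, IsVectorFieldOn Z univ ∧
    ∀ F : LocalFlow Y, ∃ G : LocalFlow Z, G.J = F.J ∧ G.U = 𝒮.κ '' F.U ∧
      ∀ t ∈ F.J, ∀ p ∈ F.U, 𝒮.κ (F.flow t p) = G.flow t (𝒮.κ p)

end PremultisymplecticSystem

end Multisymplectic

end

/-! Everything follows from naturality under a diffeomorphism `Φ = F_t`. If `X = A₁ ∧ … ∧ Aₘ` near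
`p`, then `Φ_* X` is the wedge of the pushed-forward `Aᵢ`, so local decomposability survives. As
`TΦ` is injective, `Φ_* X` stays non-zero and `𝓓(Φ_* X) = TΦ(𝓓(X))` (`wedgeKer_map_ιMulti`), so `Φ ∘
j` is integral whenever `j` is; an integral submanifold through `Φ⁻¹ q` gives one through `q`. Being
a symmetry supplies `i(F_{t*} X)Ω = 0`. For `ω = κ^*η`, a decomposable `X` has `i(X)ω ≠ 0` exactly
when the vectors `Tκ Aᵢ` are independent, `η` being a nowhere zero top-degree form. From `κ ∘ F_t =
G_t ∘ κ` the new vectors are `TG_t (Tκ Aᵢ)`, again independent because `TG_t` is injective. -/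

namespace Multisymplectic

/-! ### Decomposable multivectors and linear independence -/

section Algebra

variable {V W : Type*} [AddCommGroup V] [Module ℝ V] [AddCommGroup W] [Module ℝ W] {m : ℕ}

theorem linearIndependent_of_ιMulti_ne_zero {w : Fin m → V}
    (h : exteriorPower.ιMulti ℝ m w ≠ 0) : LinearIndependent ℝ w := by
  by_contra hw
  exact h (AlternatingMap.map_linearDependent _ _ hw)

/-- Injectivity keeps the family independent, so both annihilators are spans. Without it the image
could be zero, with the whole space as annihilator. -/
theorem wedgeKer_map_ιMulti {w : Fin m → V} (hw : LinearIndependent ℝ w) {f : V →ₗ[ℝ] W}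
    (hf : Function.Injective f) :
    wedgeKer (exteriorPower.map m f (exteriorPower.ιMulti ℝ m w)) =
      (wedgeKer (exteriorPower.ιMulti ℝ m w)).map f := by
  rw [exteriorPower.map_apply_ιMulti, wedgeKer_ιMulti (hw.map' f (LinearMap.ker_eq_bot.2 hf)),
    wedgeKer_ιMulti hw, Submodule.map_span, Set.range_comp]

/-- In dimension `m`, non-zero `m`-forms do not vanish on linearly independent families. -/
theorem alternatingMap_apply_ne_zero_iff [FiniteDimensional ℝ V]
    (hV : Module.finrank ℝ V = m) {α : V [⋀^Fin m]→ₗ[ℝ] ℝ} (hα : α ≠ 0) {w : Fin m → V} :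
    α w ≠ 0 ↔ LinearIndependent ℝ w := by
  constructor
  · intro h
    by_contra hw
    exact h (AlternatingMap.map_linearDependent _ _ hw)
  · intro hw
    have hs : Submodule.span ℝ (Set.range w) = ⊤ :=
      hw.span_eq_top_of_card_eq_finrank' (by simp [hV])
    have := (AlternatingMap.map_basis_ne_zero_iff (Module.Basis.mk hw hs.ge) α).2 hα
    simpa using this

end Algebra

/-! ### Injectivity of derivatives; open submanifolds -/

section MFDeriv

variable {k l : ℕ}
  {N : Type*} [TopologicalSpace N] [ChartedSpace (EuclideanSpace ℝ (Fin k)) N]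
  {N' : Type*} [TopologicalSpace N'] [ChartedSpace (EuclideanSpace ℝ (Fin l)) N']

/-- Chain rule applied to `g ∘ f = id` near `x`: the derivative of `g` is a left inverse. -/
theorem mfderiv_injective_of_eventually_leftInverse {f : N → N'} {g : N' → N} {x : N}
    (hf : MDifferentiableAt (𝓡 k) (𝓡 l) f x) (hg : MDifferentiableAt (𝓡 l) (𝓡 k) g (f x))
    (h : ∀ᶠ y in nhds x, g (f y) = y) :
    Function.Injective (mfderiv (𝓡 k) (𝓡 l) f x) := by
  have h1 : mfderiv (𝓡 k) (𝓡 k) (g ∘ f) x = ContinuousLinearMap.id ℝ _ :=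
    (Filter.EventuallyEq.mfderiv_eq (f₁ := g ∘ f) (f := id) h).trans mfderiv_id
  rw [mfderiv_comp x hg hf] at h1
  intro a b hab
  have ha := DFunLike.congr_fun h1 a
  have hb := DFunLike.congr_fun h1 b
  simp only [ContinuousLinearMap.comp_apply] at ha hb
  exact ha.symm.trans ((congrArg _ hab).trans hb)

theorem mfderiv_subtype_val_injective (T : Opens N) (x : T) :
    Function.Injective (mfderiv (𝓡 k) (𝓡 k) (Subtype.val : T → N) x) := by
  classical
  -- A total left inverse of the inclusion; the value `x` off `T` is arbitrary, since `T` is open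
  -- and only the germ of `g` at `x` matters.
  let g : N → T := fun y => if h : y ∈ T then ⟨y, h⟩ else x
  have hg : ∀ y : T, g y = y := fun y => by simp [g]
  refine mfderiv_injective_of_eventually_leftInverse (g := g)
    (contMDiff_subtype_val (n := 1) x |>.mdifferentiableAt one_ne_zero) ?_
    (Filter.Eventually.of_forall hg)
  refine ContMDiffAt.mdifferentiableAt (n := 1) ?_ one_ne_zero
  refine contMDiffAt_subtype_iff.1 ?_
  simp only [hg]
  exact contMDiffAt_id

/-- Both tangent spaces are the same finite-dimensional model space, so injectivity gives
surjectivity. -/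
theorem range_mfderiv_subtype_val (T : Opens N) (x : T) :
    LinearMap.range (mfderiv (𝓡 k) (𝓡 k) (Subtype.val : T → N) x).toLinearMap = ⊤ := by
  rw [LinearMap.range_eq_top]
  exact (LinearMap.injective_iff_surjective (K := ℝ) (V := EuclideanSpace ℝ (Fin k))).1
    (mfderiv_subtype_val_injective T x)

end MFDeriv

/-! ### Push-forward by a local diffeomorphism -/

section LocalDiffeomorphism

variable {k : ℕ} {N : Type*} [TopologicalSpace N] [ChartedSpace (EuclideanSpace ℝ (Fin k)) N]
  {m : ℕ} {Φ : OpenPartialHomeomorph N N}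

theorem mfderiv_injective_of_openPartialHomeomorph
    (hΦ : ContMDiffOn (𝓡 k) (𝓡 k) ∞ Φ Φ.source)
    (hΨ : ContMDiffOn (𝓡 k) (𝓡 k) ∞ Φ.symm Φ.target) {p : N} (hp : p ∈ Φ.source) :
    Function.Injective (mfderiv (𝓡 k) (𝓡 k) Φ p) :=
  mfderiv_injective_of_eventually_leftInverse (g := Φ.symm)
    ((hΦ.contMDiffAt (Φ.open_source.mem_nhds hp)).mdifferentiableAt (by simp))
    ((hΨ.contMDiffAt (Φ.open_target.mem_nhds (Φ.map_source hp))).mdifferentiableAt (by simp))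
    (Φ.eventually_left_inverse hp)

theorem pushforward_apply (X : MultivectorField k N m) {p : N} (hp : p ∈ Φ.source) :
    pushforward Φ X (Φ p) =
      (exteriorPower.map m (mfderiv (𝓡 k) (𝓡 k) Φ p).toLinearMap (X p) :) := by
  -- The tangent space depends on the base point, so `Φ.symm (Φ p) = p` cannot be rewritten in
  -- place: both sides are read in the model space and the point is generalized.
  have key : ∀ p' : N, p' = p →
      ((exteriorPower.map m (mfderiv (𝓡 k) (𝓡 k) Φ p').toLinearMap (X p') :) :
        ⋀[ℝ]^m (EuclideanSpace ℝ (Fin k))) =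
      (exteriorPower.map m (mfderiv (𝓡 k) (𝓡 k) Φ p).toLinearMap (X p) :) := by
    rintro p' rfl
    rfl
  exact key _ (Φ.left_inv hp)

/-- The push-forward of a vector field by the local diffeomorphism `Φ`. -/
noncomputable def pushforwardVectorField (Φ : OpenPartialHomeomorph N N) (A : (p : N) → TangentSpace (𝓡 k) p)
    (q : N) : TangentSpace (𝓡 k) q :=
  mfderiv (𝓡 k) (𝓡 k) Φ (Φ.symm q) (A (Φ.symm q))

/-- The push-forward is the composite `TΦ ∘ A ∘ Φ⁻¹` of smooth maps into the tangent bundle. -/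
theorem isVectorFieldOn_pushforwardVectorField [IsManifold (𝓡 k) ∞ N]
    (hΦ : ContMDiffOn (𝓡 k) (𝓡 k) ∞ Φ Φ.source)
    (hΨ : ContMDiffOn (𝓡 k) (𝓡 k) ∞ Φ.symm Φ.target)
    {A : (p : N) → TangentSpace (𝓡 k) p} {W : Set N} (hA : IsVectorFieldOn A W) :
    IsVectorFieldOn (pushforwardVectorField Φ A) (Φ.target ∩ Φ.symm ⁻¹' W) := by
  have h1 := hΦ.contMDiffOn_tangentMapWithin (m := ∞) (by simp) Φ.open_source.uniqueMDiffOn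
  have h2 : ContMDiffOn (𝓡 k) (𝓡 k).tangent ∞
      (fun q => (⟨Φ.symm q, A (Φ.symm q)⟩ : TangentBundle (𝓡 k) N)) (Φ.target ∩ Φ.symm ⁻¹' W) :=
    ContMDiffOn.comp (g := fun p => (⟨p, A p⟩ : TangentBundle (𝓡 k) N)) hA
      (hΨ.mono inter_subset_left) inter_subset_right
  have h3 := h1.comp h2 (fun q hq => Φ.map_target hq.1)
  refine h3.congr fun q hq => ?_
  have h4 : mfderivWithin (𝓡 k) (𝓡 k) Φ Φ.source (Φ.symm q) = mfderiv (𝓡 k) (𝓡 k) Φ (Φ.symm q) :=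
    mfderivWithin_of_isOpen Φ.open_source (Φ.map_target hq.1)
  simp only [Function.comp_apply, tangentMapWithin, h4]
  -- The composite has base point `Φ (Φ.symm q)` instead of `q`; again the point is generalized.
  have key : ∀ (q' : N), q' = q →
      (⟨q, (mfderiv (𝓡 k) (𝓡 k) Φ (Φ.symm q) (A (Φ.symm q)) :)⟩ : TangentBundle (𝓡 k) N) =
      ⟨q', (mfderiv (𝓡 k) (𝓡 k) Φ (Φ.symm q) (A (Φ.symm q)) :)⟩ := by
    rintro q' rfl
    rfl
  exact key _ (Φ.right_inv hq.1)

theorem IsLocallyDecomposableOn.pushforward [IsManifold (𝓡 k) ∞ N]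
    (hΦ : ContMDiffOn (𝓡 k) (𝓡 k) ∞ Φ Φ.source)
    (hΨ : ContMDiffOn (𝓡 k) (𝓡 k) ∞ Φ.symm Φ.target)
    {X : MultivectorField k N m} (hX : IsLocallyDecomposableOn X univ) :
    IsLocallyDecomposableOn (pushforward Φ X) Φ.target := by
  intro q hq
  obtain ⟨W, hWo, hqW, -, A, hA, hXA⟩ := hX (Φ.symm q) (mem_univ _)
  refine ⟨Φ.target ∩ Φ.symm ⁻¹' W, Φ.symm.isOpen_inter_preimage hWo, ⟨hq, hqW⟩,
    inter_subset_left, fun i => pushforwardVectorField Φ (A i),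
    fun i => isVectorFieldOn_pushforwardVectorField hΦ hΨ (hA i), fun q' hq' => ?_⟩
  rw [Multisymplectic.pushforward, hXA _ hq'.2]
  exact exteriorPower.map_apply_ιMulti _ _

theorem mapsIntegralSubmanifolds_pushforward [IsManifold (𝓡 k) ∞ N]
    (hΦ : ContMDiffOn (𝓡 k) (𝓡 k) ∞ Φ Φ.source)
    (hΨ : ContMDiffOn (𝓡 k) (𝓡 k) ∞ Φ.symm Φ.target)
    {X : MultivectorField k N m} (hX : ∀ p, X p ≠ 0) (hX' : IsLocallyDecomposableOn X univ) :
    MapsIntegralSubmanifolds.{_, w} Φ X (pushforward Φ X) := by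
  intro S _ _ _ _ j hj T hT
  have hmem : ∀ s : T, j s ∈ Φ.source := fun s => hT.subset s.2
  have hΦd : ∀ s : T, MDifferentiableAt (𝓡 k) (𝓡 k) Φ (j s) := fun s =>
    (hΦ.contMDiffAt (Φ.open_source.mem_nhds (hmem s))).mdifferentiableAt (by simp)
  have hjd : ∀ s : S, MDifferentiableAt (𝓡 m) (𝓡 k) j s := fun s =>
    (hj.smooth s).mdifferentiableAt (by simp)
  have hvd : ∀ s : T, MDifferentiableAt (𝓡 m) (𝓡 m) (Subtype.val : T → S) s := fun s =>
    (contMDiff_subtype_val (n := 1) s).mdifferentiableAt one_ne_zero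
  have hd : ∀ s : T, mfderiv (𝓡 m) (𝓡 k) (fun s : T => Φ (j s)) s =
      (mfderiv (𝓡 k) (𝓡 k) Φ (j s)).comp ((mfderiv (𝓡 m) (𝓡 k) j s).comp
        (mfderiv (𝓡 m) (𝓡 m) (Subtype.val : T → S) s)) := by
    intro s
    have h1 := mfderiv_comp s (hjd s) (hvd s)
    have h2 := mfderiv_comp s (g := Φ) (f := j ∘ (Subtype.val : T → S)) (hΦd s)
      ((hjd s).comp s (hvd s))
    rw [h1] at h2
    exact h2
  have hΦi : ∀ s : T, Function.Injective (mfderiv (𝓡 k) (𝓡 k) Φ (j s)) := fun s =>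
    mfderiv_injective_of_openPartialHomeomorph hΦ hΨ (hmem s)
  refine ⟨?_, ?_, ?_, fun s => Φ.map_source (hmem s), ?_⟩
  · exact hΦ.comp_contMDiff (hj.smooth.comp contMDiff_subtype_val) hmem
  · intro s s' h
    exact Subtype.ext (hj.injective (Φ.injOn (hmem s) (hmem s') h))
  · intro s
    rw [hd]
    exact (hΦi s).comp ((hj.immersion s).comp (mfderiv_subtype_val_injective T s))
  · intro s
    -- Decomposability at `j s` turns the annihilator into a span, which `TΦ` transports.
    obtain ⟨W, -, hsW, -, A, -, hXA⟩ := hX' (j s) (mem_univ _)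
    have hA : X (j s) = exteriorPower.ιMulti ℝ m (fun i => A i (j s)) := hXA _ hsW
    have hli : LinearIndependent ℝ (fun i => A i (j s)) :=
      linearIndependent_of_ιMulti_ne_zero (hA ▸ hX (j s))
    have h1 : distribution (pushforward Φ X) (Φ (j s)) =
        (distribution X (j s)).map (mfderiv (𝓡 k) (𝓡 k) Φ (j s)).toLinearMap := by
      rw [distribution, distribution, pushforward_apply X (hmem s), hA]
      exact wedgeKer_map_ιMulti hli (hΦi s)
    rw [hd, h1, ← hj.tangent]
    -- Restricting to the open set `T` loses no tangent direction.
    have h2 := range_mfderiv_subtype_val (k := m) T s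
    simp only [ContinuousLinearMap.toLinearMap_comp]
    rw [LinearMap.range_comp, LinearMap.range_comp, h2, Submodule.map_top]

theorem IsIntegrableOn.pushforward [IsManifold (𝓡 k) ∞ N]
    (hΦ : ContMDiffOn (𝓡 k) (𝓡 k) ∞ Φ Φ.source)
    (hΨ : ContMDiffOn (𝓡 k) (𝓡 k) ∞ Φ.symm Φ.target)
    {X : MultivectorField k N m} (hX : IsIntegrableOn X univ) :
    IsIntegrableOn (pushforward Φ X) Φ.target where
  ne_zero := by
    intro q hq h0
    apply hX.ne_zero (Φ.symm q) (mem_univ _)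
    refine exteriorPower.map_injective_field
      (f := (mfderiv (𝓡 k) (𝓡 k) Φ (Φ.symm q)).toLinearMap) ?_ (h0.trans (map_zero _).symm)
    exact mfderiv_injective_of_openPartialHomeomorph hΦ hΨ (Φ.map_target hq)
  locallyDecomposable := hX.locallyDecomposable.pushforward hΦ hΨ
  exists_integral := by
    intro q hq
    obtain ⟨S, _, _, _, _, j, hj, s, hs⟩ := hX.exists_integral (Φ.symm q) (mem_univ _)
    -- Only the part of `S` that `j` sends into the domain of `Φ` can be transported; it contains
    -- the preimage of `q`.
    let T : Opens S := ⟨j ⁻¹' Φ.source, Φ.open_source.preimage hj.smooth.continuous⟩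
    have hsT : s ∈ T := by
      change j s ∈ Φ.source
      rw [hs]
      exact Φ.map_target hq
    refine ⟨T, inferInstance, inferInstance, inferInstance, inferInstance, fun s : T => Φ (j s),
      mapsIntegralSubmanifolds_pushforward hΦ hΨ (fun p => hX.ne_zero p (mem_univ _))
        hX.locallyDecomposable S j hj T rfl, ⟨s, hsT⟩, ?_⟩
    simp only [hs]
    exact Φ.right_inv hq

end LocalDiffeomorphism

/-! ### Time-`t` maps of a local flow -/

section LocalFlow

variable {k : ℕ} {N : Type u} [TopologicalSpace N] [ChartedSpace (EuclideanSpace ℝ (Fin k)) N]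
  {Y : (p : N) → TangentSpace (𝓡 k) p}

theorem LocalFlow.contMDiffOn_flow (F : LocalFlow Y) {t : ℝ} (ht : t ∈ F.J) :
    ContMDiffOn (𝓡 k) (𝓡 k) ∞ (F.flow t) (F.flow t).source := by
  rw [F.source_eq t ht]
  exact F.smooth.comp (contMDiffOn_const.prodMk contMDiffOn_id) fun p hp => ⟨ht, hp⟩

end LocalFlow

/-! ### Transversality to the fibres of `κ` -/

namespace PremultisymplecticSystem

variable {m n : ℕ}
  {P : Type*} [TopologicalSpace P] [ChartedSpace (EuclideanSpace ℝ (Fin (m + n))) P]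
  [IsManifold (𝓡 (m + n)) ∞ P]
  {M : Type*} [TopologicalSpace M] [ChartedSpace (EuclideanSpace ℝ (Fin m)) M]
  [IsManifold (𝓡 m) ∞ M]
  (𝒮 : PremultisymplecticSystem m n P M)

/-- The contraction is `η` evaluated on the projected vectors in reverse order, and a non-zero top
form detects bases; reordering does not affect independence. -/
theorem contractTop_volForm_ne_zero_iff (p : P) (w : Fin m → TangentSpace (𝓡 (m + n)) p) :
    contractTop (exteriorPower.ιMulti ℝ m w) (𝒮.volForm p).toAlternatingMap ≠ 0 ↔
      LinearIndependent ℝ (fun i => mfderiv (𝓡 (m + n)) (𝓡 m) 𝒮.κ p (w i)) := by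
  have hη : (𝒮.η (𝒮.κ p)).toAlternatingMap ≠ 0 := fun h =>
    𝒮.η_ne_zero (𝒮.κ p) (ContinuousAlternatingMap.toAlternatingMap_injective h)
  have hfd : FiniteDimensional ℝ (TangentSpace (𝓡 m) (𝒮.κ p)) :=
    inferInstanceAs (FiniteDimensional ℝ (EuclideanSpace ℝ (Fin m)))
  have hfr : Module.finrank ℝ (TangentSpace (𝓡 m) (𝒮.κ p)) = m :=
    finrank_euclideanSpace_fin (𝕜 := ℝ)
  have hr := alternatingMap_apply_ne_zero_iff hfr hη
    (w := fun i => mfderiv (𝓡 (m + n)) (𝓡 m) 𝒮.κ p (w (Fin.rev i)))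
  rw [contractTop_ιMulti]
  refine hr.trans ?_
  exact linearIndependent_equiv Fin.revPerm
    (f := fun i => mfderiv (𝓡 (m + n)) (𝓡 m) 𝒮.κ p (w i))

/-- A local diffeomorphism over a local diffeomorphism of the base preserves the condition
`i(X)ω ≠ 0` for decomposable multivectors. -/
theorem contractTop_volForm_map_ne_zero {Φ : OpenPartialHomeomorph P P}
    {Γ : OpenPartialHomeomorph M M}
    (hΦ : ContMDiffOn (𝓡 (m + n)) (𝓡 (m + n)) ∞ Φ Φ.source)
    (hΓ : ContMDiffOn (𝓡 m) (𝓡 m) ∞ Γ Γ.source)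
    (hΓ' : ContMDiffOn (𝓡 m) (𝓡 m) ∞ Γ.symm Γ.target)
    (hκ : ∀ p ∈ Φ.source, 𝒮.κ p ∈ Γ.source ∧ 𝒮.κ (Φ p) = Γ (𝒮.κ p))
    {p : P} (hp : p ∈ Φ.source) (w : Fin m → TangentSpace (𝓡 (m + n)) p)
    (hw : contractTop (exteriorPower.ιMulti ℝ m w) (𝒮.volForm p).toAlternatingMap ≠ 0) :
    contractTop (exteriorPower.ιMulti ℝ m fun i => mfderiv (𝓡 (m + n)) (𝓡 (m + n)) Φ p (w i))
      (𝒮.volForm (Φ p)).toAlternatingMap ≠ 0 := by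
  rw [contractTop_volForm_ne_zero_iff] at hw ⊢
  have hκd : ∀ q, MDifferentiableAt (𝓡 (m + n)) (𝓡 m) 𝒮.κ q := fun q =>
    (𝒮.κ_smooth q).mdifferentiableAt (by simp)
  have hΦd : MDifferentiableAt (𝓡 (m + n)) (𝓡 (m + n)) Φ p :=
    (hΦ.contMDiffAt (Φ.open_source.mem_nhds hp)).mdifferentiableAt (by simp)
  have hΓd : MDifferentiableAt (𝓡 m) (𝓡 m) Γ (𝒮.κ p) :=
    (hΓ.contMDiffAt (Γ.open_source.mem_nhds (hκ p hp).1)).mdifferentiableAt (by simp)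
  have h : mfderiv (𝓡 (m + n)) (𝓡 m) (𝒮.κ ∘ Φ) p = mfderiv (𝓡 (m + n)) (𝓡 m) (Γ ∘ 𝒮.κ) p :=
    Filter.EventuallyEq.mfderiv_eq
      -- The two composites agree on the open domain of `Φ`, hence have equal derivatives at `p`.
      (Filter.mem_of_superset (Φ.open_source.mem_nhds hp) fun q hq => (hκ q hq).2)
  rw [mfderiv_comp p (hκd _) hΦd, mfderiv_comp p hΓd (hκd p)] at h
  have hi := mfderiv_injective_of_openPartialHomeomorph hΓ hΓ' (hκ p hp).1
  have hli := hw.map' (mfderiv (𝓡 m) (𝓡 m) Γ (𝒮.κ p)).toLinearMap (LinearMap.ker_eq_bot.2 hi)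
  convert! hli using 1
  funext i
  exact DFunLike.congr_fun h (w i)

end PremultisymplecticSystem

end Multisymplectic

/-! ### The theorem -/

theorem mainTheorem7 {m n : ℕ} (hm : 1 ≤ m)
    {P : Type u} [TopologicalSpace P] [T2Space P] [SecondCountableTopology P]
    [ChartedSpace (EuclideanSpace ℝ (Fin (m + n))) P] [IsManifold (𝓡 (m + n)) ∞ P]
    {M : Type v} [TopologicalSpace M] [T2Space M] [SecondCountableTopology M]
    [ChartedSpace (EuclideanSpace ℝ (Fin m)) M] [IsManifold (𝓡 m) ∞ M]
    (𝒮 : Multisymplectic.PremultisymplecticSystem m n P M)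
    (Y : (p : P) → TangentSpace (𝓡 (m + n)) p) (hY : 𝒮.IsInfinitesimalSymmetry Y)
    (F : Multisymplectic.LocalFlow Y) (t : ℝ) (ht : t ∈ F.J) :
    (∀ X ∈ 𝒮.kerOn univ, Multisymplectic.IsIntegrableOn X univ →
      Multisymplectic.IsIntegrableOn (Multisymplectic.pushforward (F.flow t) X)
        (F.flow t).target ∧
      Multisymplectic.MapsIntegralSubmanifolds.{u, w} (F.flow t) X
        (Multisymplectic.pushforward (F.flow t) X)) ∧
    (𝒮.IsProjectable Y → ∀ X ∈ 𝒮.kerIntegrableOn univ,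
      Multisymplectic.MapsIntegralSubmanifolds.{u, w} (F.flow t) X
        (Multisymplectic.pushforward (F.flow t) X) ∧
      Multisymplectic.pushforward (F.flow t) X ∈ 𝒮.kerIntegrableOn (F.flow t).target) := by
  have hΦ := F.contMDiffOn_flow ht
  have hΨ := F.smooth_symm t ht
  have hmaps : ∀ X : Multisymplectic.MultivectorField (m + n) P m,
      Multisymplectic.IsIntegrableOn X univ →
      Multisymplectic.MapsIntegralSubmanifolds.{u, w} (F.flow t) X
        (Multisymplectic.pushforward (F.flow t) X) := fun X hX =>
    Multisymplectic.mapsIntegralSubmanifolds_pushforward hΦ hΨ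
      (fun p => hX.ne_zero p (mem_univ _)) hX.locallyDecomposable
  refine ⟨fun X _ hX => ⟨hX.pushforward hΦ hΨ, hmaps X hX⟩, ?_⟩
  rintro ⟨Z, -, hZ⟩ X ⟨hXΩ, hXω, hX⟩
  refine ⟨hmaps X hX, hY.2 F t ht X hXΩ, fun q hq => ?_, hX.pushforward hΦ hΨ⟩
  obtain ⟨G, hGJ, hGU, hFG⟩ := hZ F
  have htG : t ∈ G.J := hGJ ▸ ht
  -- Writing `q` as `F_t p` lets the push-forward be computed at `p`, where `X` is decomposed.
  obtain ⟨p, hp, rfl⟩ : ∃ p ∈ (F.flow t).source, F.flow t p = q :=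
    ⟨_, (F.flow t).map_target hq, (F.flow t).right_inv hq⟩
  obtain ⟨W, -, hpW, -, A, -, hXA⟩ := hX.locallyDecomposable p (mem_univ _)
  have hA := hXA p hpW
  have hne := hXω p (mem_univ _)
  rw [hA] at hne
  rw [Multisymplectic.pushforward_apply X hp, hA]
  have hmap := 𝒮.contractTop_volForm_map_ne_zero hΦ (G.contMDiffOn_flow htG)
    (G.smooth_symm t htG) (fun p hp => ?_) hp _ hne
  · convert! hmap using 2
    exact exteriorPower.map_apply_ιMulti _ _
  -- The base flow is defined on exactly `κ(U)`, so it is available at `κ p` for each `p` in `U`.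
  · rw [F.source_eq t ht] at hp
    rw [G.source_eq t htG, hGU]
    exact ⟨mem_image_of_mem _ hp, hFG t ht p hp⟩
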